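/- Let $t_0\in\mathbb{R}$, $a>0$, $I=(t_0-a,t_0+a)$, and let $f$ be a real function that is operator convex on $I$ (that is, $f(\lambda A+(1-\lambda)B)\le \lambda f(A)+(1-\lambda)f(B)$ for all Hermitian matrices $A,B$ of the same size with spectrum in $I$ and all $0\le\lambda\le 1$) and not affine on $I$. Suppose that $f$ is \emph{diffused}: in the integral representation $$f(t)=b+ct+d\int_{[-a,a]}\frac{(t-t_0)^2}{a^2-(t-t_0)x}\,d\mu(x),\qquad t\in I,$$ with $b,c\in\mathbb{R}$, $d>0$ and $\mu$ a probability measure on $[-a,a]$, the Lebesgue density $p_X$ of (the absolutely continuous part of) $\mu$ is strictly positive a.e. on a nondegenerate subinterval of $[-a,a]$ that has $x=0$ as an interior or a boundary point. For strictly positive matrices $\rho,\sigma$ of the same size put $$S_f(\rho\|\sigma)=\operatorname{vec}(\sqrt{\rho})^\dagger\, f\!\left(\sigma\otimes(\rho^{-1})^{\mathsf T}\right)\operatorname{vec}(\sqrt{\rho}),$$ where $\operatorname{vec}$ lists the entries of a matrix row by row and the spectrum of $\sigma\otimes(\rho^{-1})^{\mathsf T}$ is supposed to lie in $I$. Let $\rho_{AB}$,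 $\sigma_{AB}$ be strictly positive matrices on a finite-dimensional composite system $AB$ such that the spectrum of $\sigma_{AB}\otimes(\rho_{AB}^{-1})^{\mathsf T}$ lies in $I$, and let $\rho_A=\operatorname{Tr}_B\rho_{AB}$, $\sigma_A=\operatorname{Tr}_B\sigma_{AB}$. Then $$S_f(\rho_{AB}\|\sigma_{AB})\ge S_f(\rho_A\|\sigma_A),$$ and equality holds if and only if $$\operatorname{Tr}\left(\sigma_{AB}^{\imath t}\rho_{AB}^{-\imath t+1}\right)=\operatorname{Tr}\left(\sigma_A^{\imath t}\rho_A^{-\imath t+1}\right)\quad\text{for all } t\in\mathbb{C},\qquad \imath=\sqrt{-1}.$$ -/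

import Mathlib

open scoped ComplexOrder

noncomputable section

namespace FRelEntropy

open MeasureTheory Matrix
open scoped Kronecker

/-- A real function `f` is operator convex on `s`: for Hermitian matrices `A`, `B` of any size with
spectrum in `s`, `f (l A + (1 - l) B) ≤ l f(A) + (1 - l) f(B)` in the Loewner order, `f` being
applied by the functional calculus of Hermitian matrices. -/
def OperatorConvexOn (s : Set ℝ) (f : ℝ → ℝ) : Prop :=
  ∀ (n : ℕ) (A B : Matrix (Fin n) (Fin n) ℂ), A.IsHermitian → B.IsHermitian →
    spectrum ℝ A ⊆ s → spectrum ℝ B ⊆ s → ∀ l : ℝ, 0 ≤ l → l ≤ 1 →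
      (l • cfc f A + (1 - l) • cfc f B - cfc f (l • A + (1 - l) • B)).PosSemidef

/-- `f` is affine on `s`. -/
def AffineOn (s : Set ℝ) (f : ℝ → ℝ) : Prop :=
  ∃ b c : ℝ, ∀ t ∈ s, f t = b + c * t

/-- The probability measure `μ` on `[-a, a]` represents `f` on `(t₀ - a, t₀ + a)`:
`f t = b + c t + d ∫ (t - t₀)² / (a² - (t - t₀) x) dμ(x)` with real `b`, `c` and `d > 0`.
The denominator is positive on `[-a, a]`, so the integrand is bounded there. -/
def Represents (t₀ a : ℝ) (f : ℝ → ℝ) (μ : Measure ℝ) : Prop :=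
  IsProbabilityMeasure μ ∧ μ (Set.Icc (-a) a)ᶜ = 0 ∧
    ∃ b c d : ℝ, 0 < d ∧ ∀ t ∈ Set.Ioo (t₀ - a) (t₀ + a),
      f t = b + c * t + d * ∫ x, (t - t₀) ^ 2 / (a ^ 2 - (t - t₀) * x) ∂μ

/-- `f` is diffused on `(t₀ - a, t₀ + a)`: the density, with respect to Lebesgue measure, of its
representing probability measure is strictly positive a.e. on a nondegenerate subinterval of
`[-a, a]` that has `0` as an interior or a boundary point. The representing measure need not be
absolutely continuous: the density is that of its absolutely continuous part, which is the usual
density when the measure has one. -/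
def IsDiffused (t₀ a : ℝ) (f : ℝ → ℝ) : Prop :=
  ∃ μ : Measure ℝ, Represents t₀ a f μ ∧
    ∃ u v : ℝ, u < v ∧ -a ≤ u ∧ u ≤ 0 ∧ 0 ≤ v ∧ v ≤ a ∧
      ∀ᵐ x ∂(volume.restrict (Set.Ioo u v)), 0 < μ.rnDeriv volume x

variable {m n : Type*} [Fintype m] [DecidableEq m] [Fintype n] [DecidableEq n]

/-- Row-by-row vectorization of a square matrix, so that
`rowVec (A * B * C) = (A ⊗ₖ Cᵀ) *ᵥ rowVec B`. -/
def rowVec (A : Matrix n n ℂ) : n × n → ℂ := fun p => A p.1 p.2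

/-- The matrix `σ ⊗ (ρ⁻¹)ᵀ`. -/
def modular (ρ σ : Matrix n n ℂ) : Matrix (n × n) (n × n) ℂ := σ ⊗ₖ (ρ⁻¹)ᵀ

/-- The `f`-relative entropy `S_f(ρ‖σ) = vec(√ρ)† f(σ ⊗ (ρ⁻¹)ᵀ) vec(√ρ)` of positive definite
matrices. The quadratic form of a Hermitian matrix is real, so taking the real part only changes
the type. -/
def fRelEntropy (f : ℝ → ℝ) (ρ σ : Matrix n n ℂ) : ℝ :=
  (star (rowVec (cfc Real.sqrt ρ)) ⬝ᵥ (cfc f (modular ρ σ) *ᵥ rowVec (cfc Real.sqrt ρ))).re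

/-- The partial trace over the second system `n` of a matrix on the composite system `m × n`. -/
def traceSnd (M : Matrix (m × n) (m × n) ℂ) : Matrix m m ℂ :=
  fun i j => ∑ k, M (i, k) (j, k)

/-- The complex power `A ^ z = exp (z ln A)` of a positive definite matrix. -/
def cpow (A : Matrix n n ℂ) (z : ℂ) : Matrix n n ℂ :=
  NormedSpace.exp (z • cfc Real.log A)

end FRelEntropy

end

noncomputable section

namespace FRelEntropy

open MeasureTheory Matrix
open scoped Kronecker

/-! ### Finite signed sums and the integral representation -/

section RealSums

variable {ι : Type*} [Fintype ι]

/-! There is an isometry `V` (`modularIsometry`) with `V vec √ρ_A = vec √ρ` that compresses the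
modular matrix `Δ` of the pair `ρ`, `σ` to `Δ_A = V* Δ V`, that of the marginals. Monotonicity is
thus a Jensen inequality for compressions (`compression_le_and_eq_iff`). It suffices to prove it for
the kernels `(t - t₀)² / (a² - (t - t₀) x)`, where completing a square gives it
(`posSemidef_compression_kernel`); the affine part contributes nothing to the gap.

In eigenbases of `Δ` and `Δ_A` the gap is a finite signed sum `∑ c k * f (s k)`. If it is zero, the
kernel gaps, being nonnegative, vanish `μ`-a.e., hence Lebesgue-a.e. on the interval where the
density is positive, hence for infinitely many `x`. Partial fractions then make the sum vanish for
every function in place of `f` (`sum_mul_comp_nonneg_and_eq_zero`), so all moments of `Δ` and `Δ_A`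
agree. Conversely, equal moments suffice by interpolation. The `k`-th moment is `Tr (σ^k ρ^(1-k))`,
and interpolation also passes between natural and complex exponents
(`trace_cpow_eq_iff_forall_nat`). -/

theorem sum_mul_comp_eq_sum_image (c s : ι → ℝ) (h : ℝ → ℝ) :
    ∑ k, c k * h (s k) =
      ∑ y ∈ Finset.univ.image s, (∑ k with s k = y, c k) * h y := by
  rw [← Finset.sum_fiberwise_of_maps_to (s := Finset.univ) (t := Finset.univ.image s) (g := s)
    (fun k _ => Finset.mem_image_of_mem s (Finset.mem_univ k))]
  refine Finset.sum_congr rfl fun y _ => ?_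
  rw [Finset.sum_mul]
  refine Finset.sum_congr rfl fun k hk => ?_
  rw [(Finset.mem_filter.1 hk).2]

/-- Partial fractions: if `∑ C y / (r - y x)` vanishes for infinitely many `x`, then `C y = 0` for
every nonzero `y`. -/
theorem coeff_eq_zero_of_sum_div_eq_zero (S : Finset ℝ) (C : ℝ → ℝ) {r : ℝ} (hr : r ≠ 0)
    {Z : Set ℝ} (hZ : Z.Infinite) (hden : ∀ x ∈ Z, ∀ y ∈ S, r - y * x ≠ 0)
    (hsum : ∀ x ∈ Z, ∑ y ∈ S, C y / (r - y * x) = 0) {y : ℝ} (hy : y ∈ S) (hy0 : y ≠ 0) :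
    C y = 0 := by
  classical
  -- The sum of fractions multiplied by its common denominator.
  let P : Polynomial ℝ := ∑ y ∈ S, Polynomial.C (C y) *
    ∏ w ∈ S.erase y, (Polynomial.C r - Polynomial.C w * Polynomial.X)
  have hev : ∀ x, P.eval x = ∑ y ∈ S, C y * ∏ w ∈ S.erase y, (r - w * x) := fun x => by
    simp [P, Polynomial.eval_finsetSum, Polynomial.eval_prod]
  have hP : P = 0 := by
    refine Polynomial.eq_zero_of_infinite_isRoot P (hZ.mono fun x hx => ?_)
    change P.eval x = 0
    have h1 : P.eval x = (∏ w ∈ S, (r - w * x)) * ∑ y ∈ S, C y / (r - y * x) := by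
      rw [hev, Finset.mul_sum]
      refine Finset.sum_congr rfl fun y hy => ?_
      rw [← Finset.mul_prod_erase S _ hy]
      rw [mul_right_comm, mul_comm (_ - _) (C y / _), div_mul_cancel₀ _ (hden x hx y hy)]
    rw [h1, hsum x hx, mul_zero]
  -- At `r / y`, the root of `r - y x`, only the summand of `y` survives, and its other factors are
  -- nonzero.
  have h2 := hev (r / y)
  rw [hP, Polynomial.eval_zero, Finset.sum_eq_single_of_mem y hy] at h2
  · rcases mul_eq_zero.1 h2.symm with h | h
    · exact h
    · obtain ⟨w, hw, h⟩ := Finset.prod_eq_zero_iff.1 h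
      have hne := Finset.ne_of_mem_erase hw
      field_simp at h
      simp only [mul_zero, mul_eq_zero, hr, false_or] at h
      exact absurd (by linarith) hne
  · intro w _ hwy
    rw [Finset.prod_eq_zero (Finset.mem_erase.2 ⟨hwy.symm, hy⟩), mul_zero]
    field_simp
    ring

/-- The kernel vanishes at the node `0`, so partial fractions only reach the nonzero nodes; the
weight at `0` is recovered from the total weight being zero. -/
theorem sum_mul_comp_eq_zero_of_infinite (c s : ι → ℝ) {a : ℝ} (ha : 0 < a) (h0 : ∑ k, c k = 0)
    {Z : Set ℝ} (hZ : Z.Infinite) (hden : ∀ x ∈ Z, ∀ k, a ^ 2 - s k * x ≠ 0)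
    (hsum : ∀ x ∈ Z, ∑ k, c k * (s k ^ 2 / (a ^ 2 - s k * x)) = 0) (h : ℝ → ℝ) :
    ∑ k, c k * h (s k) = 0 := by
  have hC : ∀ y ∈ Finset.univ.image s, y ≠ 0 → ∑ k with s k = y, c k = 0 := by
    intro y hy hy0
    have := coeff_eq_zero_of_sum_div_eq_zero (Finset.univ.image s)
      (fun y => (∑ k with s k = y, c k) * y ^ 2) (pow_ne_zero 2 ha.ne') hZ
      (fun x hx y hy => by
        obtain ⟨k, -, rfl⟩ := Finset.mem_image.1 hy
        exact hden x hx k)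
      (fun x hx => by
        rw [← hsum x hx, sum_mul_comp_eq_sum_image c s fun y => y ^ 2 / (a ^ 2 - y * x)]
        exact Finset.sum_congr rfl fun y _ => mul_div_assoc _ _ _) hy hy0
    exact (mul_eq_zero.1 this).resolve_right (pow_ne_zero 2 hy0)
  have h1 : ∀ g : ℝ → ℝ, ∑ k, c k * g (s k) = (∑ k with s k = 0, c k) * g 0 := by
    intro g
    rw [sum_mul_comp_eq_sum_image]
    by_cases hm : (0 : ℝ) ∈ Finset.univ.image s
    · refine Finset.sum_eq_single_of_mem _ hm fun y hy hy0 => ?_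
      rw [hC y hy hy0, zero_mul]
    · have : (Finset.univ.filter fun k => s k = 0) = ∅ :=
        Finset.filter_eq_empty_iff.2 fun k _ hk =>
          hm (Finset.mem_image.2 ⟨k, Finset.mem_univ k, hk⟩)
      rw [this, Finset.sum_empty, zero_mul]
      refine Finset.sum_eq_zero fun y hy => ?_
      rw [hC y hy (fun h => hm (h ▸ hy)), zero_mul]
  have h2 := h1 fun _ => 1
  simp only [mul_one, h0] at h2
  rw [h1, ← h2, zero_mul]

theorem sub_mul_pos_of_mem_Ioo {t₀ a t x : ℝ} (ht : t ∈ Set.Ioo (t₀ - a) (t₀ + a))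
    (hx : x ∈ Set.Icc (-a) a) : 0 < a ^ 2 - (t - t₀) * x := by
  obtain ⟨h1, h2⟩ := ht
  obtain ⟨h3, h4⟩ := hx
  have ha : 0 < a := by linarith
  have h5 : |t - t₀| < a := abs_lt.2 ⟨by linarith, by linarith⟩
  have h6 : |x| ≤ a := abs_le.2 ⟨h3, h4⟩
  have h7 : (t - t₀) * x ≤ |t - t₀| * |x| := by rw [← abs_mul]; exact le_abs_self _
  nlinarith [abs_nonneg (t - t₀), abs_nonneg x]

theorem integrable_kernel {t₀ a t : ℝ} (ht : t ∈ Set.Ioo (t₀ - a) (t₀ + a)) (μ : Measure ℝ)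
    [IsProbabilityMeasure μ] (hμ : μ (Set.Icc (-a) a)ᶜ = 0) :
    Integrable (fun x => (t - t₀) ^ 2 / (a ^ 2 - (t - t₀) * x)) μ := by
  have hc : ContinuousOn (fun x => (t - t₀) ^ 2 / (a ^ 2 - (t - t₀) * x)) (Set.Icc (-a) a) := by
    refine ContinuousOn.div (by fun_prop) (by fun_prop) fun x hx => ?_
    exact (sub_mul_pos_of_mem_Ioo ht hx).ne'
  have h := hc.integrableOn_compact (μ := μ) isCompact_Icc
  rwa [IntegrableOn, Measure.restrict_eq_self_of_ae_mem] at h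
  exact hμ

/-- A signed finite sum which annihilates affine functions and is nonnegative on the kernels of the
integral representation is nonnegative on a represented function. If the representing measure is
diffused, then it vanishes there only if it vanishes on all functions. -/
theorem sum_mul_comp_nonneg_and_eq_zero {t₀ a : ℝ} (ha : 0 < a) {f : ℝ → ℝ}
    (hf : IsDiffused t₀ a f) (c s : ι → ℝ) (hs : ∀ k, s k ∈ Set.Ioo (t₀ - a) (t₀ + a))
    (h0 : ∑ k, c k = 0) (h1 : ∑ k, c k * s k = 0)
    (hpos : ∀ x ∈ Set.Icc (-a) a, 0 ≤ ∑ k, c k * ((s k - t₀) ^ 2 / (a ^ 2 - (s k - t₀) * x))) :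
    0 ≤ ∑ k, c k * f (s k) ∧
      (∑ k, c k * f (s k) = 0 → ∀ h : ℝ → ℝ, ∑ k, c k * h (s k) = 0) := by
  obtain ⟨μ, ⟨hprob, hsupp, b, e, d, hd, hrep⟩, u, v, huv, hu, -, -, hv, hdens⟩ := hf
  let D : ℝ → ℝ := fun x => ∑ k, c k * ((s k - t₀) ^ 2 / (a ^ 2 - (s k - t₀) * x))
  have hmem : ∀ᵐ x ∂μ, x ∈ Set.Icc (-a) a := hsupp
  have hint : Integrable D μ :=
    integrable_finsetSum _ fun k _ => (integrable_kernel (hs k) μ hsupp).const_mul _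
  have hDnn : 0 ≤ᵐ[μ] D := hmem.mono fun x hx => hpos x hx
  have hF : ∑ k, c k * f (s k) = d * ∫ x, D x ∂μ := by
    rw [integral_finsetSum _ fun k _ => (integrable_kernel (hs k) μ hsupp).const_mul _]
    have : ∀ k, c k * f (s k) = b * c k + e * (c k * s k) +
        d * ∫ x, c k * ((s k - t₀) ^ 2 / (a ^ 2 - (s k - t₀) * x)) ∂μ := fun k => by
      rw [hrep _ (hs k), integral_const_mul]; ring
    simp_rw [this, Finset.sum_add_distrib, ← Finset.mul_sum, h0, h1]
    ring
  refine ⟨hF ▸ mul_nonneg hd.le (integral_nonneg_of_ae hDnn), fun hz h => ?_⟩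
  have hD0 : D =ᵐ[μ] 0 :=
    (integral_eq_zero_iff_of_nonneg_ae hDnn hint).1
      ((mul_eq_zero.1 (hF.symm.trans hz)).resolve_left hd.ne')
  -- The absolutely continuous part of `μ` is at most `μ`, so `D` also vanishes a.e. for it, and
  -- positivity of the density transfers this to Lebesgue measure on `(u, v)`.
  have hD1 : ∀ᵐ x ∂(volume.withDensity (μ.rnDeriv volume)), D x = 0 :=
    (Measure.absolutelyContinuous_of_le (Measure.withDensity_rnDeriv_le μ volume)).ae_le hD0
  rw [ae_withDensity_iff (Measure.measurable_rnDeriv μ volume)] at hD1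
  have hD2 : ∀ᵐ x ∂(volume.restrict (Set.Ioo u v)), D x = 0 := by
    filter_upwards [hdens, ae_restrict_of_ae hD1] with x hx1 hx2 using hx2 hx1.ne'
  have hZ : (Set.Ioo u v ∩ {x | D x = 0}).Infinite := by
    intro hfin
    rw [ae_restrict_iff' measurableSet_Ioo] at hD2
    have h3 : volume (Set.Ioo u v ∩ {x | D x = 0}) = 0 := hfin.measure_zero _
    have h4 : volume (Set.Ioo u v) = 0 := by
      refine measure_mono_null (t := (Set.Ioo u v ∩ {x | D x = 0}) ∪
        {x | ¬ (x ∈ Set.Ioo u v → D x = 0)}) (fun x hx => ?_) (measure_union_null h3 hD2)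
      by_cases hx0 : D x = 0
      · exact Or.inl ⟨hx, hx0⟩
      · exact Or.inr fun h => hx0 (h hx)
    rw [Real.volume_Ioo, ENNReal.ofReal_eq_zero] at h4
    linarith
  have hIcc : ∀ x ∈ Set.Ioo u v, x ∈ Set.Icc (-a) a :=
    fun x hx => ⟨hu.trans hx.1.le, hx.2.le.trans hv⟩
  have := sum_mul_comp_eq_zero_of_infinite c (fun k => s k - t₀) ha h0 hZ
    (fun x hx k => (sub_mul_pos_of_mem_Ioo (hs k) (hIcc x hx.1)).ne') (fun x hx => hx.2)
    (fun y => h (y + t₀))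
  simpa using this

/-- A finite sum `∑ c k * h (s k)` vanishes for all `h` once all its moments vanish. -/
theorem sum_mul_comp_eq_zero_of_moments {K : Type*} [Field K] (c : ι → K) (s : ι → ℝ) (i : ℝ →+* K)
    (hm : ∀ n : ℕ, ∑ k, c k * i (s k) ^ n = 0) (h : ℝ → K) : ∑ k, c k * h (s k) = 0 := by
  classical
  -- On the finitely many nodes `h` agrees with a polynomial, whose sum is a combination of moments.
  let P : Polynomial K := Lagrange.interpolate (Finset.univ.image s) (fun y => i y) h
  have hP : ∀ k, P.eval (i (s k)) = h (s k) := fun k =>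
    Lagrange.eval_interpolate_at_node h (i.injective.injOn)
      (Finset.mem_image_of_mem s (Finset.mem_univ k))
  simp_rw [← hP, Polynomial.eval_eq_sum_range, Finset.mul_sum]
  rw [Finset.sum_comm]
  refine Finset.sum_eq_zero fun n _ => ?_
  rw [← mul_zero (P.coeff n), ← hm n, Finset.mul_sum]
  exact Finset.sum_congr rfl fun k _ => by ring

end RealSums

/-! ### Spectral weights and Jensen's inequality for compressions -/

section Compression

variable {m n : Type*} [Fintype m] [DecidableEq m] [Fintype n] [DecidableEq n]

theorem cfc_eq_conj_diagonal {M : Matrix n n ℂ} (hM : M.IsHermitian) (h : ℝ → ℝ) :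
    cfc h M = (hM.eigenvectorUnitary : Matrix n n ℂ) *
      diagonal (fun i => (h (hM.eigenvalues i) : ℂ)) *
        (hM.eigenvectorUnitary : Matrix n n ℂ)ᴴ := by
  rw [hM.cfc_eq, IsHermitian.cfc, Unitary.conjStarAlgAut_apply]
  rfl

/-- The weight which the vector `w` puts on the `i`-th eigenvector of the Hermitian matrix `M`. -/
def spectralWeight {M : Matrix n n ℂ} (hM : M.IsHermitian) (w : n → ℂ) (i : n) : ℝ :=
  Complex.normSq (((hM.eigenvectorUnitary : Matrix n n ℂ)ᴴ *ᵥ w) i)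

theorem dotProduct_cfc_mulVec {M : Matrix n n ℂ} (hM : M.IsHermitian) (h : ℝ → ℝ) (w : n → ℂ) :
    star w ⬝ᵥ (cfc h M *ᵥ w) =
      ((∑ i, spectralWeight hM w i * h (hM.eigenvalues i) : ℝ) : ℂ) := by
  rw [cfc_eq_conj_diagonal hM, ← mulVec_mulVec, ← mulVec_mulVec, dotProduct_mulVec]
  have : star w ᵥ* (hM.eigenvectorUnitary : Matrix n n ℂ) =
      star ((hM.eigenvectorUnitary : Matrix n n ℂ)ᴴ *ᵥ w) := by
    rw [star_mulVec, conjTranspose_conjTranspose]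
  rw [this, dotProduct, Complex.ofReal_sum]
  refine Finset.sum_congr rfl fun i _ => ?_
  rw [mulVec_diagonal, spectralWeight, Complex.ofReal_mul, Complex.normSq_eq_conj_mul_self]
  simp only [Pi.star_apply, RCLike.star_def]
  ring

theorem posSemidef_cfc {M : Matrix n n ℂ} (hM : M.IsHermitian) (h : ℝ → ℝ)
    (hh : ∀ t ∈ spectrum ℝ M, 0 ≤ h t) : (cfc h M).PosSemidef := by
  rw [cfc_eq_conj_diagonal hM]
  refine PosSemidef.mul_mul_conjTranspose_same (PosSemidef.diagonal fun i => ?_) _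
  exact Complex.zero_le_real.2 (hh _ (hM.eigenvalues_mem_spectrum_real i))

/-- The spectrum is finite, so the functional calculus applies to arbitrary functions. -/
theorem continuousOn_spectrum {M : Matrix n n ℂ} (h : ℝ → ℝ) :
    ContinuousOn h (spectrum ℝ M) :=
  (finite_real_spectrum (A := M)).continuousOn h

theorem star_mulVec_dotProduct_mulVec {m n : Type*} [Fintype m] [Fintype n] (V : Matrix n m ℂ)
    (M : Matrix n n ℂ) (w : m → ℂ) :
    star (V *ᵥ w) ⬝ᵥ (M *ᵥ (V *ᵥ w)) = star w ⬝ᵥ ((Vᴴ * M * V) *ᵥ w) := by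
  rw [star_mulVec, ← dotProduct_mulVec, mulVec_mulVec, mulVec_mulVec]

theorem star_mulVec_dotProduct_self {m n : Type*} [Fintype m] [DecidableEq m] [Fintype n]
    {V : Matrix n m ℂ} (hV : Vᴴ * V = 1) (w : m → ℂ) :
    star (V *ᵥ w) ⬝ᵥ (V *ᵥ w) = star w ⬝ᵥ w := by
  rw [star_mulVec, ← dotProduct_mulVec, mulVec_mulVec, hV, one_mulVec]

theorem sum_spectralWeight {M : Matrix n n ℂ} (hM : M.IsHermitian) (w : n → ℂ) :
    ((∑ i, spectralWeight hM w i : ℝ) : ℂ) = star w ⬝ᵥ w := by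
  have hsa : IsSelfAdjoint M := hM
  have := dotProduct_cfc_mulVec hM (fun _ => 1) w
  rw [cfc_const_one ℝ M hsa, one_mulVec] at this
  simpa using this.symm

theorem sum_spectralWeight_mul_pow {M : Matrix n n ℂ} (hM : M.IsHermitian) (w : n → ℂ) (k : ℕ) :
    ((∑ i, spectralWeight hM w i * hM.eigenvalues i ^ k : ℝ) : ℂ) = star w ⬝ᵥ (M ^ k *ᵥ w) := by
  have hsa : IsSelfAdjoint M := hM
  rw [← dotProduct_cfc_mulVec hM (fun t => t ^ k), cfc_pow_id M k hsa]

/-- The spectrum of a compression of `M` lies in every interval that contains the spectrum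
of `M`. -/
theorem eigenvalues_compression_mem {M : Matrix n n ℂ} (hM : M.IsHermitian) {I : Set ℝ}
    (hI : Convex ℝ I) (hspec : ∀ i, hM.eigenvalues i ∈ I) {V : Matrix n m ℂ} (hV : Vᴴ * V = 1)
    (hN : (Vᴴ * M * V).IsHermitian) (j : m) : hN.eigenvalues j ∈ I := by
  -- For a unit eigenvector `e` of the compression, its eigenvalue is the mean of the eigenvalues of
  -- `M` under the spectral weights of `V e`.
  let e : m → ℂ := ⇑(hN.eigenvectorBasis j)
  have he : star e ⬝ᵥ e = 1 := by
    have h := orthonormal_iff_ite.1 hN.eigenvectorBasis.orthonormal j j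
    rw [if_pos rfl] at h
    rw [EuclideanSpace.inner_eq_star_dotProduct, dotProduct_comm] at h
    exact h
  have h0 := sum_spectralWeight hM (V *ᵥ e)
  rw [star_mulVec_dotProduct_self hV, he] at h0
  have h1 := sum_spectralWeight_mul_pow hM (V *ᵥ e) 1
  rw [pow_one, star_mulVec_dotProduct_mulVec] at h1
  have h2 : hN.eigenvalues j = ∑ i, spectralWeight hM (V *ᵥ e) i * hM.eigenvalues i := by
    rw [hN.eigenvalues_eq]
    change RCLike.re (star e ⬝ᵥ _) = _
    rw [← h1]
    simp
  rw [h2]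
  exact hI.sum_mem (fun i _ => Complex.normSq_nonneg _) (by exact_mod_cast h0)
    fun i _ => hspec i

/-- The kernel of the integral representation factors through the resolvent. -/
theorem exists_resolvent_of_spectrum_subset {L : Matrix n n ℂ} (hL : L.IsHermitian) {t₀ a x : ℝ}
    (hsL : spectrum ℝ L ⊆ Set.Ioo (t₀ - a) (t₀ + a)) (hx : x ∈ Set.Icc (-a) a) :
    ∃ R : Matrix n n ℂ,
      R.IsHermitian ∧ (a ^ 2 • (1 : Matrix n n ℂ) - x • (L - t₀ • (1 : Matrix n n ℂ))) * R = 1 ∧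
      R * (a ^ 2 • (1 : Matrix n n ℂ) - x • (L - t₀ • (1 : Matrix n n ℂ))) = 1 ∧
      cfc (fun t => (t - t₀) ^ 2 / (a ^ 2 - (t - t₀) * x)) L =
        (L - t₀ • (1 : Matrix n n ℂ)) * R * (L - t₀ • (1 : Matrix n n ℂ)) ∧
      (a ^ 2 • (1 : Matrix n n ℂ) - x • (L - t₀ • (1 : Matrix n n ℂ))).PosSemidef := by
  have hsa : IsSelfAdjoint L := hL
  have c : ∀ h : ℝ → ℝ, ContinuousOn h (spectrum ℝ L) := continuousOn_spectrum
  have hpos : ∀ t ∈ spectrum ℝ L, 0 < a ^ 2 - (t - t₀) * x := fun t ht =>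
    sub_mul_pos_of_mem_Ioo (hsL ht) hx
  have h1 : cfc (fun t => t - t₀) L = L - t₀ • (1 : Matrix n n ℂ) := by
    rw [cfc_sub (fun t => t) (fun _ => t₀) L (c _) (c _), cfc_id' ℝ L, cfc_const t₀ L,
      Algebra.algebraMap_eq_smul_one]
  have h2 : cfc (fun t => a ^ 2 - (t - t₀) * x) L =
      a ^ 2 • (1 : Matrix n n ℂ) - x • (L - t₀ • (1 : Matrix n n ℂ)) := by
    rw [cfc_sub (fun _ => a ^ 2) (fun t => (t - t₀) * x) L (c _) (c _), cfc_const _ L,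
      Algebra.algebraMap_eq_smul_one, ← h1, ← cfc_const_mul x _ L (c _)]
    simp_rw [mul_comm x]
  refine ⟨cfc (fun t => (a ^ 2 - (t - t₀) * x)⁻¹) L, cfc_predicate _ _, ?_, ?_, ?_, ?_⟩
  · rw [← h2, ← cfc_mul _ _ L (c _) (c _), ← cfc_const_one ℝ L]
    exact cfc_congr fun t ht => mul_inv_cancel₀ (hpos t ht).ne'
  · rw [← h2, ← cfc_mul _ _ L (c _) (c _), ← cfc_const_one ℝ L]
    exact cfc_congr fun t ht => inv_mul_cancel₀ (hpos t ht).ne'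
  · rw [← h1, ← cfc_mul _ _ L (c _) (c _), ← cfc_mul _ _ L (c _) (c _)]
    exact cfc_congr fun t ht => by simp only [div_eq_mul_inv]; ring
  · rw [← h2]
    exact posSemidef_cfc hL _ fun t ht => (hpos t ht).le

/-- Operator Jensen inequality for the kernels of the integral representation. -/
theorem posSemidef_compression_kernel {M : Matrix n n ℂ} (hM : M.IsHermitian) {t₀ a x : ℝ}
    (hspec : spectrum ℝ M ⊆ Set.Ioo (t₀ - a) (t₀ + a)) (hx : x ∈ Set.Icc (-a) a)
    {V : Matrix n m ℂ} (hV : Vᴴ * V = 1)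
    (hspecN : spectrum ℝ (Vᴴ * M * V) ⊆ Set.Ioo (t₀ - a) (t₀ + a)) :
    (Vᴴ * cfc (fun t => (t - t₀) ^ 2 / (a ^ 2 - (t - t₀) * x)) M * V -
      cfc (fun t => (t - t₀) ^ 2 / (a ^ 2 - (t - t₀) * x)) (Vᴴ * M * V)).PosSemidef := by
  have hN : (Vᴴ * M * V).IsHermitian := isHermitian_conjTranspose_mul_mul V hM
  obtain ⟨R, hR, hKR, hRK, hg, hK⟩ := exists_resolvent_of_spectrum_subset hM hspec hx
  obtain ⟨R', hR', hKR', hRK', hg', -⟩ := exists_resolvent_of_spectrum_subset hN hspecN hx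
  rw [hg, hg']
  set S := M - t₀ • (1 : Matrix n n ℂ) with hS
  set K := a ^ 2 • (1 : Matrix n n ℂ) - x • S with hKdef
  set T := Vᴴ * M * V - t₀ • (1 : Matrix m m ℂ) with hT
  have hST : Vᴴ * S * V = T := by
    rw [hS, hT, Matrix.mul_sub, Matrix.sub_mul, Matrix.mul_smul, Matrix.smul_mul,
      Matrix.mul_one, hV]
  have hKK : Vᴴ * K * V = a ^ 2 • (1 : Matrix m m ℂ) - x • T := by
    rw [hKdef, Matrix.mul_sub, Matrix.sub_mul, Matrix.mul_smul, Matrix.smul_mul,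
      Matrix.mul_one, hV, Matrix.mul_smul, Matrix.smul_mul, hST]
  set K' := a ^ 2 • (1 : Matrix m m ℂ) - x • T
  have hSh : Sᴴ = S := by
    rw [hS, conjTranspose_sub, hM.eq, conjTranspose_smul, conjTranspose_one, star_trivial]
  have hTh : Tᴴ = T := by
    rw [hT, conjTranspose_sub, hN.eq, conjTranspose_smul, conjTranspose_one, star_trivial]
  -- Completing the square: in `(R S V - V R' T)* K (R S V - V R' T)` both cross terms and the last
  -- square equal `T R' T`, which leaves exactly the Jensen gap.
  have h := hK.conjTranspose_mul_mul_same (R * S * V - V * R' * T)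
  convert h using 1
  simp only [conjTranspose_sub, conjTranspose_mul, hSh, hTh, hR.eq, hR'.eq]
  have e1 : Vᴴ * (S * R) * K * (R * S * V) = Vᴴ * (S * R * S) * V := by
    calc _ = Vᴴ * (S * (R * K) * R * S) * V := by simp only [Matrix.mul_assoc]
      _ = _ := by rw [hRK, Matrix.mul_one]
  have e2 : Vᴴ * (S * R) * K * (V * R' * T) = T * R' * T := by
    calc _ = (Vᴴ * (S * (R * K)) * V) * R' * T := by simp only [Matrix.mul_assoc]
      _ = _ := by rw [hRK, Matrix.mul_one, hST]
  have e3 : T * (R' * Vᴴ) * K * (R * S * V) = T * R' * T := by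
    calc _ = T * R' * (Vᴴ * (K * R * S) * V) := by simp only [Matrix.mul_assoc]
      _ = _ := by rw [hKR, Matrix.one_mul, hST]
  have e4 : T * (R' * Vᴴ) * K * (V * R' * T) = T * R' * T := by
    calc _ = T * R' * (Vᴴ * K * V * R') * T := by simp only [Matrix.mul_assoc]
      _ = _ := by rw [hKK, hKR', Matrix.mul_one]
  simp only [Matrix.sub_mul, Matrix.mul_sub, ← Matrix.mul_assoc] at e1 e2 e3 e4 ⊢
  rw [e1, e2, e3, e4]
  abel

/-- Monotonicity of the quadratic form of a diffused function under compressions, with equality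
exactly when all moments agree. -/
theorem compression_le_and_eq_iff {t₀ a : ℝ} (ha : 0 < a) {f : ℝ → ℝ} (hf : IsDiffused t₀ a f)
    {M : Matrix n n ℂ} (hM : M.IsHermitian)
    (hspec : spectrum ℝ M ⊆ Set.Ioo (t₀ - a) (t₀ + a)) {V : Matrix n m ℂ} (hV : Vᴴ * V = 1)
    (w : m → ℂ) :
    (star w ⬝ᵥ (cfc f (Vᴴ * M * V) *ᵥ w)).re ≤
        (star (V *ᵥ w) ⬝ᵥ (cfc f M *ᵥ (V *ᵥ w))).re ∧
      ((star (V *ᵥ w) ⬝ᵥ (cfc f M *ᵥ (V *ᵥ w))).re =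
          (star w ⬝ᵥ (cfc f (Vᴴ * M * V) *ᵥ w)).re ↔
        ∀ k : ℕ, star (V *ᵥ w) ⬝ᵥ (M ^ k *ᵥ (V *ᵥ w)) =
          star w ⬝ᵥ ((Vᴴ * M * V) ^ k *ᵥ w)) := by
  have hN : (Vᴴ * M * V).IsHermitian := isHermitian_conjTranspose_mul_mul V hM
  have hMI : ∀ i, hM.eigenvalues i ∈ Set.Ioo (t₀ - a) (t₀ + a) :=
    fun i => hspec (hM.eigenvalues_mem_spectrum_real i)
  have hNI : ∀ j, hN.eigenvalues j ∈ Set.Ioo (t₀ - a) (t₀ + a) :=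
    eigenvalues_compression_mem hM (convex_Ioo _ _) hMI hV hN
  have hspecN : spectrum ℝ (Vᴴ * M * V) ⊆ Set.Ioo (t₀ - a) (t₀ + a) := by
    rw [hN.spectrum_real_eq_range_eigenvalues]
    rintro _ ⟨j, rfl⟩
    exact hNI j
  let c : n ⊕ m → ℝ :=
    Sum.elim (spectralWeight hM (V *ᵥ w)) fun j => -spectralWeight hN w j
  let s : n ⊕ m → ℝ := Sum.elim hM.eigenvalues hN.eigenvalues
  have hF : ∀ h : ℝ → ℝ, ∑ k, c k * h (s k) =
      (star (V *ᵥ w) ⬝ᵥ (cfc h M *ᵥ (V *ᵥ w))).re -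
        (star w ⬝ᵥ (cfc h (Vᴴ * M * V) *ᵥ w)).re := fun h => by
    rw [dotProduct_cfc_mulVec hM, dotProduct_cfc_mulVec hN, Complex.ofReal_re, Complex.ofReal_re]
    simp [c, s, sub_eq_add_neg]
  have hpow : ∀ k : ℕ, ((∑ i, c i * s i ^ k : ℝ) : ℂ) =
      star (V *ᵥ w) ⬝ᵥ (M ^ k *ᵥ (V *ᵥ w)) - star w ⬝ᵥ ((Vᴴ * M * V) ^ k *ᵥ w) := fun k => by
    rw [← sum_spectralWeight_mul_pow hM, ← sum_spectralWeight_mul_pow hN]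
    simp [c, s, sub_eq_add_neg]
  -- Moments 0 and 1 agree automatically: `V` is an isometry, and the second matrix is the
  -- compression of `M`.
  have h0 : ∑ k, c k = 0 := by
    have := hpow 0
    simp only [pow_zero, mul_one, one_mulVec, star_mulVec_dotProduct_self hV, sub_self] at this
    exact_mod_cast this
  have h1 : ∑ k, c k * s k = 0 := by
    have := hpow 1
    simp only [pow_one, star_mulVec_dotProduct_mulVec, sub_self] at this
    exact_mod_cast this
  have hs : ∀ k, s k ∈ Set.Ioo (t₀ - a) (t₀ + a) := by
    rintro (i | j)
    · exact hMI i
    · exact hNI j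
  obtain ⟨hle, heq⟩ := sum_mul_comp_nonneg_and_eq_zero ha hf c s hs h0 h1 fun x hx => by
    rw [hF fun t => (t - t₀) ^ 2 / (a ^ 2 - (t - t₀) * x), star_mulVec_dotProduct_mulVec,
      ← Complex.sub_re, ← dotProduct_sub, ← sub_mulVec]
    exact (posSemidef_compression_kernel hM hspec hx hV hspecN).re_dotProduct_nonneg w
  rw [hF] at hle heq
  refine ⟨sub_nonneg.1 hle, fun h k => ?_, fun h => ?_⟩
  · rw [← sub_eq_zero, ← hpow, heq (sub_eq_zero.2 h) fun t => t ^ k, Complex.ofReal_zero]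
  · rw [← sub_eq_zero, ← hF]
    refine sum_mul_comp_eq_zero_of_moments c s (RingHom.id ℝ) (fun k => ?_) f
    have := hpow k
    rw [h k, sub_self] at this
    exact_mod_cast this

end Compression

/-! ### Vectorization and Kronecker products -/

section Vectorization

variable {n : Type*} [Fintype n]

theorem kronecker_mulVec_rowVec (X Y Z : Matrix n n ℂ) :
    (X ⊗ₖ Zᵀ) *ᵥ rowVec Y = rowVec (X * Y * Z) := by
  ext ⟨i, j⟩
  simp only [mulVec, dotProduct, rowVec, mul_apply, kronecker_apply, transpose_apply,
    Fintype.sum_prod_type, Finset.sum_mul]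
  rw [Finset.sum_comm]
  exact Finset.sum_congr rfl fun _ _ => Finset.sum_congr rfl fun _ _ => by ring

theorem star_rowVec_dotProduct_rowVec (X Y : Matrix n n ℂ) :
    star (rowVec X) ⬝ᵥ rowVec Y = (Xᴴ * Y).trace := by
  simp only [dotProduct, rowVec, trace, diag, mul_apply, conjTranspose_apply, Pi.star_apply,
    Fintype.sum_prod_type]
  exact Finset.sum_comm

theorem kronecker_pow [DecidableEq n] (X Y : Matrix n n ℂ) (k : ℕ) :
    (X ⊗ₖ Y) ^ k = (X ^ k) ⊗ₖ (Y ^ k) := by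
  induction k with
  | zero => simp
  | succ k ih => rw [pow_succ, pow_succ, pow_succ, ih, mul_kronecker_mul]

end Vectorization

/-! ### The partial trace as a compression -/

section PartialTrace

variable {A B : Type*} [Fintype A] [DecidableEq A] [Fintype B] [DecidableEq B]

/-- The matrix of the embedding `X ↦ X ⊗ 1` of the operators on the first system into those on the
composite system, in terms of row-by-row vectorizations. -/
def embedding (A B : Type*) [DecidableEq A] [DecidableEq B] :
    Matrix ((A × B) × (A × B)) (A × A) ℂ :=
  fun p q => if p.1.2 = p.2.2 then if p.1.1 = q.1 then if p.2.1 = q.2 then 1 else 0 else 0 else 0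

theorem embedding_mulVec_one {A B : Type*} [Fintype A] [DecidableEq A] [DecidableEq B] :
    embedding A B *ᵥ rowVec (1 : Matrix A A ℂ) = rowVec (1 : Matrix (A × B) (A × B) ℂ) := by
  ext ⟨⟨a, b⟩, a', b'⟩
  by_cases h : b = b' <;>
    simp [mulVec, dotProduct, rowVec, embedding, Fintype.sum_prod_type, one_apply, h, eq_comm]

theorem embedding_conj_kronecker_apply (X Z : Matrix (A × B) (A × B) ℂ) (p q : A × A) :
    ((embedding A B)ᴴ * (X ⊗ₖ Z) * embedding A B) p q =
      ∑ b, ∑ b', X (p.1, b) (q.1, b') * Z (p.2, b) (q.2, b') := by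
  have h1 : ∀ r, ((embedding A B)ᴴ * (X ⊗ₖ Z)) p r =
      ∑ b, X (p.1, b) r.1 * Z (p.2, b) r.2 := fun r => by
    simp only [mul_apply, conjTranspose_apply, embedding, apply_ite star,
      star_one, star_zero, ite_mul, one_mul, zero_mul, Fintype.sum_prod_type]
    rw [Finset.sum_eq_single p.1 (by intro _ _ h; simp [h]) (by simp)]
    refine Finset.sum_congr rfl fun b _ => ?_
    rw [Finset.sum_eq_single p.2 (by intro _ _ h; simp [h]) (by simp)]
    simp
  rw [mul_apply]
  simp only [h1, embedding, mul_ite, mul_one, mul_zero, Fintype.sum_prod_type]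
  rw [Finset.sum_eq_single q.1 (by intro _ _ h; simp [h]) (by simp), Finset.sum_comm]
  rw [Finset.sum_eq_single q.2 (by intro _ _ h; simp [h]) (by simp), Finset.sum_comm]
  simp only [if_true, Finset.sum_ite_eq', Finset.mem_univ]
  exact Finset.sum_comm

/-- The identity factor forces `b = b'` in the double sum over the second system, which is the
partial trace. -/
theorem embedding_conj_kronecker_one (X : Matrix (A × B) (A × B) ℂ) :
    (embedding A B)ᴴ * (X ⊗ₖ (1 : Matrix (A × B) (A × B) ℂ)) * embedding A B =
      traceSnd X ⊗ₖ (1 : Matrix A A ℂ) := by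
  ext p q
  rw [embedding_conj_kronecker_apply, kronecker_apply, traceSnd]
  by_cases h : p.2 = q.2 <;> simp [one_apply, h]

theorem embedding_conj_one_kronecker (X : Matrix (A × B) (A × B) ℂ) :
    (embedding A B)ᴴ * ((1 : Matrix (A × B) (A × B) ℂ) ⊗ₖ Xᵀ) * embedding A B =
      (1 : Matrix A A ℂ) ⊗ₖ (traceSnd X)ᵀ := by
  ext p q
  rw [embedding_conj_kronecker_apply, kronecker_apply, transpose_apply, traceSnd]
  by_cases h : p.1 = q.1 <;> simp [one_apply, h]

theorem posDef_traceSnd {A B : Type*} [Fintype B] [Nonempty B]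
    {X : Matrix (A × B) (A × B) ℂ} (hX : X.PosDef) :
    (traceSnd X).PosDef := by
  have h : traceSnd X = ∑ b, X.submatrix (fun a => (a, b)) fun a => (a, b) := by
    ext i j
    simp [traceSnd, Matrix.sum_apply]
  rw [h]
  exact posDef_sum Finset.univ_nonempty fun b _ =>
    hX.submatrix fun x y hxy => (Prod.ext_iff.1 hxy).1

end PartialTrace

/-! ### Square roots, complex powers and moments -/

section Powers

variable {n : Type*} [Fintype n] [DecidableEq n]

theorem posDef_modular {ρ σ : Matrix n n ℂ} (hρ : ρ.PosDef) (hσ : σ.PosDef) :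
    (modular ρ σ).PosDef :=
  hσ.kronecker hρ.inv.transpose

theorem cfc_sqrt_mul_self {ρ : Matrix n n ℂ} (hρ : ρ.PosDef) :
    cfc Real.sqrt ρ * cfc Real.sqrt ρ = ρ := by
  have hsa : IsSelfAdjoint ρ := hρ.isHermitian
  rw [← cfc_mul _ _ ρ (continuousOn_spectrum _) (continuousOn_spectrum _)]
  conv_rhs => rw [← cfc_id' ℝ ρ]
  refine cfc_congr fun t ht => Real.mul_self_sqrt ?_
  rw [hρ.isHermitian.spectrum_real_eq_range_eigenvalues] at ht
  obtain ⟨i, rfl⟩ := ht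
  exact (hρ.eigenvalues_pos i).le

theorem isHermitian_cfc_sqrt (ρ : Matrix n n ℂ) : (cfc Real.sqrt ρ).IsHermitian :=
  cfc_predicate (p := IsSelfAdjoint) Real.sqrt ρ

theorem isUnit_det_cfc_sqrt {ρ : Matrix n n ℂ} (hρ : ρ.PosDef) :
    IsUnit (cfc Real.sqrt ρ).det := by
  have h : IsUnit ρ.det := (isUnit_iff_isUnit_det ρ).1 hρ.isUnit
  rw [← cfc_sqrt_mul_self hρ, det_mul] at h
  exact isUnit_of_mul_isUnit_left h

theorem cfc_sqrt_mul_inv {ρ : Matrix n n ℂ} (hρ : ρ.PosDef) :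
    cfc Real.sqrt ρ * ρ⁻¹ = (cfc Real.sqrt ρ)⁻¹ := by
  refine (inv_eq_right_inv ?_).symm
  rw [← mul_assoc, cfc_sqrt_mul_self hρ, mul_nonsing_inv _ ((isUnit_iff_isUnit_det ρ).1 hρ.isUnit)]

theorem inv_mul_cfc_sqrt {ρ : Matrix n n ℂ} (hρ : ρ.PosDef) :
    ρ⁻¹ * cfc Real.sqrt ρ = (cfc Real.sqrt ρ)⁻¹ := by
  refine (inv_eq_left_inv ?_).symm
  rw [mul_assoc, cfc_sqrt_mul_self hρ, nonsing_inv_mul _ ((isUnit_iff_isUnit_det ρ).1 hρ.isUnit)]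

theorem cpow_eq_conj_diagonal {ρ : Matrix n n ℂ} (hρ : ρ.IsHermitian) (z : ℂ) :
    cpow ρ z = (hρ.eigenvectorUnitary : Matrix n n ℂ) *
      diagonal (fun i => Complex.exp (z * Real.log (hρ.eigenvalues i))) *
        (hρ.eigenvectorUnitary : Matrix n n ℂ)ᴴ := by
  have hU : (hρ.eigenvectorUnitary : Matrix n n ℂ)ᴴ * hρ.eigenvectorUnitary = 1 :=
    Unitary.coe_star_mul_self hρ.eigenvectorUnitary
  rw [cpow, cfc_eq_conj_diagonal hρ, ← Matrix.smul_mul, ← Matrix.mul_smul, ← diagonal_smul,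
    ← inv_eq_left_inv hU,
    exp_conj _ _ ((isUnit_iff_isUnit_det _).2 (isUnit_det_of_left_inverse hU)), exp_diagonal]
  congr 3
  ext i
  rw [Pi.coe_exp]
  simp [Complex.exp_eq_exp_ℂ]

theorem cpow_add (ρ : Matrix n n ℂ) (z w : ℂ) : cpow ρ (z + w) = cpow ρ z * cpow ρ w := by
  rw [cpow, add_smul, exp_add_of_commute, cpow, cpow]
  exact ((Commute.refl _).smul_left z).smul_right w

theorem cpow_one {ρ : Matrix n n ℂ} (hρ : ρ.PosDef) : cpow ρ 1 = ρ := by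
  have hsa : IsSelfAdjoint ρ := hρ.isHermitian
  rw [cpow_eq_conj_diagonal hρ.isHermitian]
  conv_rhs => rw [← cfc_id' ℝ ρ, cfc_eq_conj_diagonal hρ.isHermitian]
  congr 3
  ext i
  rw [one_mul, ← Complex.ofReal_exp, Real.exp_log (hρ.eigenvalues_pos i)]

theorem cpow_natCast {ρ : Matrix n n ℂ} (hρ : ρ.PosDef) (k : ℕ) : cpow ρ k = ρ ^ k := by
  conv_rhs => rw [← cpow_one hρ, cpow, one_smul, ← exp_nsmul]
  rw [cpow, Nat.cast_smul_eq_nsmul]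

theorem cpow_neg_natCast {ρ : Matrix n n ℂ} (hρ : ρ.PosDef) (k : ℕ) :
    cpow ρ (-k) = ρ⁻¹ ^ k := by
  conv_rhs => rw [← cpow_one hρ, cpow, one_smul, ← exp_neg, ← exp_nsmul]
  rw [cpow, neg_smul, Nat.cast_smul_eq_nsmul, smul_neg]

/-- The traces `Tr (σ ^ z ρ ^ (1 - z))` are a finite sum of exponentials of `z`. -/
theorem exists_trace_cpow_mul_cpow_eq_sum {ρ σ : Matrix n n ℂ} (hρ : ρ.PosDef) (hσ : σ.PosDef) :
    ∃ (c : n × n → ℂ) (s : n × n → ℝ), (∀ k, 0 < s k) ∧ ∀ z : ℂ,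
      (cpow σ z * cpow ρ (-z + 1)).trace = ∑ k, c k * Complex.exp (z * Real.log (s k)) := by
  set U := (hσ.isHermitian.eigenvectorUnitary : Matrix n n ℂ) with hU
  set W := (hρ.isHermitian.eigenvectorUnitary : Matrix n n ℂ) with hW
  let r := hρ.isHermitian.eigenvalues
  let q := hσ.isHermitian.eigenvalues
  have hr : ∀ i, 0 < r i := hρ.eigenvalues_pos
  have hq : ∀ i, 0 < q i := hσ.eigenvalues_pos
  -- The weights are the squared overlaps of the eigenvectors of `σ` and `ρ`, times the eigenvalue
  -- of `ρ` that comes from the `+ 1` in its exponent; the nodes are the eigenvalue ratios.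
  refine ⟨fun p => (Uᴴ * W) p.1 p.2 * (Wᴴ * U) p.2 p.1 * r p.2, fun p => q p.1 / r p.2,
    fun p => div_pos (hq _) (hr _), fun z => ?_⟩
  rw [cpow_eq_conj_diagonal hσ.isHermitian, cpow_eq_conj_diagonal hρ.isHermitian, ← hU, ← hW]
  rw [Matrix.mul_assoc U, Matrix.mul_assoc U, trace_mul_comm]
  simp only [Matrix.mul_assoc]
  rw [← Matrix.mul_assoc Uᴴ]
  simp only [trace, diag, diagonal_mul]
  rw [Fintype.sum_prod_type]
  refine Finset.sum_congr rfl fun i _ => ?_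
  rw [mul_apply, Finset.mul_sum]
  refine Finset.sum_congr rfl fun j _ => ?_
  rw [diagonal_mul, Real.log_div (hq i).ne' (hr j).ne', Complex.ofReal_sub, mul_sub, sub_eq_add_neg,
    Complex.exp_add, add_mul, one_mul, Complex.exp_add, ← Complex.ofReal_exp,
    Real.exp_log (hρ.eigenvalues_pos j), neg_mul]
  ring

/-- The moments of the modular matrix in the vector `vec √ρ`. -/
theorem star_rowVec_sqrt_dotProduct_modular_pow {ρ σ : Matrix n n ℂ} (hρ : ρ.PosDef)
    (hσ : σ.PosDef) (k : ℕ) :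
    star (rowVec (cfc Real.sqrt ρ)) ⬝ᵥ (modular ρ σ ^ k *ᵥ rowVec (cfc Real.sqrt ρ)) =
      (cpow σ k * cpow ρ (-k + 1)).trace := by
  rw [modular, kronecker_pow, ← transpose_pow, kronecker_mulVec_rowVec,
    star_rowVec_dotProduct_rowVec, (isHermitian_cfc_sqrt ρ).eq, cpow_natCast hσ, cpow_add,
    cpow_neg_natCast hρ, cpow_one hρ]
  have hcomm : Commute (cfc Real.sqrt ρ) (ρ⁻¹ ^ k) :=
    Commute.pow_right ((cfc_sqrt_mul_inv hρ).trans (inv_mul_cfc_sqrt hρ).symm) k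
  rw [mul_assoc (σ ^ k), hcomm.eq, trace_mul_comm, mul_assoc, mul_assoc, cfc_sqrt_mul_self hρ]

/-- The trace condition for all complex exponents amounts to equality of all moments. -/
theorem trace_cpow_eq_iff_forall_nat {m : Type*} [Fintype m] [DecidableEq m]
    {ρ σ : Matrix n n ℂ} (hρ : ρ.PosDef) (hσ : σ.PosDef) {ρ' σ' : Matrix m m ℂ}
    (hρ' : ρ'.PosDef) (hσ' : σ'.PosDef) :
    (∀ k : ℕ, (cpow σ k * cpow ρ (-k + 1)).trace = (cpow σ' k * cpow ρ' (-k + 1)).trace) ↔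
      ∀ t : ℂ, (cpow σ (Complex.I * t) * cpow ρ (-(Complex.I * t) + 1)).trace =
        (cpow σ' (Complex.I * t) * cpow ρ' (-(Complex.I * t) + 1)).trace := by
  obtain ⟨c, s, hs, h⟩ := exists_trace_cpow_mul_cpow_eq_sum hρ hσ
  obtain ⟨c', s', hs', h'⟩ := exists_trace_cpow_mul_cpow_eq_sum hρ' hσ'
  refine ⟨fun hk t => ?_, fun ht k => ?_⟩
  · have hexp : ∀ (k : ℕ) {x : ℝ}, 0 < x → Complex.exp (k * Real.log x) = (x : ℂ) ^ k := by
      intro k x hx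
      rw [Complex.exp_nat_mul, ← Complex.ofReal_exp, Real.exp_log hx]
    -- Natural exponents are the moments of the combined signed sum; the test function is `x ↦ x ^
    -- (i t)`.
    have := sum_mul_comp_eq_zero_of_moments (Sum.elim c fun k => -c' k) (Sum.elim s s')
      Complex.ofRealHom (fun k => ?_) fun x => Complex.exp (Complex.I * t * Real.log x)
    · rw [h, h', ← sub_eq_zero, ← this]
      simp [sub_eq_add_neg]
    · have := hk k
      rw [h, h', ← sub_eq_zero] at this
      simp only [hexp k (hs _), hexp k (hs' _)] at this
      rw [← this]
      simp [sub_eq_add_neg]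
  · have := ht (-Complex.I * k)
    rwa [show Complex.I * (-Complex.I * k) = k by
      rw [← mul_assoc, mul_neg, Complex.I_mul_I, neg_neg, one_mul]] at this

end Powers

/-! ### The isometry between the modular matrices -/

section Monotonicity

variable {A B : Type*} [Fintype A] [DecidableEq A] [Fintype B] [DecidableEq B]

/-- The isometry `vec (X √ρ_A) ↦ vec ((X ⊗ 1) √ρ)`. -/
def modularIsometry (ρ : Matrix (A × B) (A × B) ℂ) : Matrix ((A × B) × (A × B)) (A × A) ℂ :=
  ((1 : Matrix (A × B) (A × B) ℂ) ⊗ₖ (cfc Real.sqrt ρ)ᵀ) * embedding A B *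
    ((1 : Matrix A A ℂ) ⊗ₖ ((cfc Real.sqrt (traceSnd ρ))⁻¹)ᵀ)

theorem conjTranspose_modularIsometry (ρ : Matrix (A × B) (A × B) ℂ) :
    (modularIsometry ρ)ᴴ = ((1 : Matrix A A ℂ) ⊗ₖ ((cfc Real.sqrt (traceSnd ρ))⁻¹)ᵀ) *
      (embedding A B)ᴴ * ((1 : Matrix (A × B) (A × B) ℂ) ⊗ₖ (cfc Real.sqrt ρ)ᵀ) := by
  rw [modularIsometry, conjTranspose_mul, conjTranspose_mul, conjTranspose_kronecker,
    conjTranspose_kronecker, conjTranspose_one, conjTranspose_one,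
    ((isHermitian_cfc_sqrt ρ).transpose).eq, ((isHermitian_cfc_sqrt _).inv.transpose).eq,
    Matrix.mul_assoc]

theorem modularIsometry_conj (ρ : Matrix (A × B) (A × B) ℂ)
    (X : Matrix ((A × B) × (A × B)) ((A × B) × (A × B)) ℂ) :
    (modularIsometry ρ)ᴴ * X * modularIsometry ρ =
      ((1 : Matrix A A ℂ) ⊗ₖ ((cfc Real.sqrt (traceSnd ρ))⁻¹)ᵀ) *
        ((embedding A B)ᴴ * (((1 : Matrix (A × B) (A × B) ℂ) ⊗ₖ (cfc Real.sqrt ρ)ᵀ) * X *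
          ((1 : Matrix (A × B) (A × B) ℂ) ⊗ₖ (cfc Real.sqrt ρ)ᵀ)) *
          embedding A B) * ((1 : Matrix A A ℂ) ⊗ₖ ((cfc Real.sqrt (traceSnd ρ))⁻¹)ᵀ) := by
  rw [conjTranspose_modularIsometry, modularIsometry]
  simp only [Matrix.mul_assoc]

variable [Nonempty B] {ρ : Matrix (A × B) (A × B) ℂ}

/-- The embedding compresses `1 ⊗ ρᵀ` to `1 ⊗ ρ_Aᵀ`, which the outer factors `ρ_A^(-1/2)` normalize
to `1`. -/
theorem conjTranspose_modularIsometry_mul_self (hρ : ρ.PosDef) :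
    (modularIsometry ρ)ᴴ * modularIsometry ρ = 1 := by
  have hA := posDef_traceSnd hρ
  have hu := isUnit_det_cfc_sqrt hA
  have h := modularIsometry_conj ρ 1
  rw [Matrix.mul_one, Matrix.mul_one, ← mul_kronecker_mul, ← transpose_mul, cfc_sqrt_mul_self hρ,
    Matrix.one_mul, embedding_conj_one_kronecker, ← mul_kronecker_mul, ← mul_kronecker_mul,
    ← transpose_mul, ← transpose_mul, Matrix.one_mul, Matrix.one_mul] at h
  rw [h]
  nth_rw 2 [← cfc_sqrt_mul_self hA]
  rw [Matrix.mul_assoc (cfc Real.sqrt (traceSnd ρ)), mul_nonsing_inv _ hu, Matrix.mul_one,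
    nonsing_inv_mul _ hu, transpose_one, one_kronecker_one]

/-- The factors `√ρ` cancel `ρ⁻¹`, so the embedding only sees `σ ⊗ 1` and yields `σ_A ⊗ 1`; the
outer factors then restore `ρ_A⁻¹`. -/
theorem modularIsometry_conj_modular (hρ : ρ.PosDef) (σ : Matrix (A × B) (A × B) ℂ) :
    (modularIsometry ρ)ᴴ * modular ρ σ * modularIsometry ρ =
      modular (traceSnd ρ) (traceSnd σ) := by
  have hA := posDef_traceSnd hρ
  rw [modularIsometry_conj, modular, ← mul_kronecker_mul, ← mul_kronecker_mul, ← transpose_mul,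
    ← transpose_mul, Matrix.one_mul, Matrix.mul_one, inv_mul_cfc_sqrt hρ,
    mul_nonsing_inv _ (isUnit_det_cfc_sqrt hρ), transpose_one, embedding_conj_kronecker_one,
    ← mul_kronecker_mul, ← mul_kronecker_mul, Matrix.one_mul, Matrix.mul_one, Matrix.mul_one,
    ← transpose_mul, ← Matrix.mul_inv_rev, cfc_sqrt_mul_self hA, modular]

theorem modularIsometry_mulVec (hρ : ρ.PosDef) :
    modularIsometry ρ *ᵥ rowVec (cfc Real.sqrt (traceSnd ρ)) = rowVec (cfc Real.sqrt ρ) := by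
  rw [modularIsometry, ← mulVec_mulVec, ← mulVec_mulVec, kronecker_mulVec_rowVec, Matrix.one_mul,
    mul_nonsing_inv _ (isUnit_det_cfc_sqrt (posDef_traceSnd hρ)), embedding_mulVec_one,
    kronecker_mulVec_rowVec, Matrix.one_mul, Matrix.one_mul]

end Monotonicity
end FRelEntropy

end

open FRelEntropy in
theorem lemma3 {A B : Type*} [Fintype A] [DecidableEq A] [Nonempty A]
    [Fintype B] [DecidableEq B] [Nonempty B]
    (f : ℝ → ℝ) (t₀ a : ℝ) (ha : 0 < a)
    (hconv : OperatorConvexOn (Set.Ioo (t₀ - a) (t₀ + a)) f)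
    (hnonaffine : ¬ AffineOn (Set.Ioo (t₀ - a) (t₀ + a)) f)
    (hdiff : IsDiffused t₀ a f)
    (ρ σ : Matrix (A × B) (A × B) ℂ) (hρ : ρ.PosDef) (hσ : σ.PosDef)
    (hspec : spectrum ℝ (modular ρ σ) ⊆ Set.Ioo (t₀ - a) (t₀ + a)) :
    fRelEntropy f (traceSnd ρ) (traceSnd σ) ≤ fRelEntropy f ρ σ ∧
      (fRelEntropy f ρ σ = fRelEntropy f (traceSnd ρ) (traceSnd σ) ↔
        ∀ t : ℂ,
          (cpow σ (Complex.I * t) * cpow ρ (-(Complex.I * t) + 1)).trace =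
            (cpow (traceSnd σ) (Complex.I * t) *
              cpow (traceSnd ρ) (-(Complex.I * t) + 1)).trace) := by
  have hρA := posDef_traceSnd hρ
  have hσA := posDef_traceSnd hσ
  obtain ⟨hle, heq⟩ := compression_le_and_eq_iff ha hdiff (posDef_modular hρ hσ).isHermitian hspec
    (conjTranspose_modularIsometry_mul_self hρ) (rowVec (cfc Real.sqrt (traceSnd ρ)))
  simp only [modularIsometry_conj_modular hρ, modularIsometry_mulVec hρ,
    star_rowVec_sqrt_dotProduct_modular_pow hρ hσ,
    star_rowVec_sqrt_dotProduct_modular_pow hρA hσA] at hle heq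
  exact ⟨hle, heq.trans (trace_cpow_eq_iff_forall_nat hρ hσ hρA hσA)⟩
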